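/- For a commutative ring $R$, a probabilistic matrix over $R$ is a probability distribution $\mathcal M$ on matrices over $R$ of a fixed size. It computes a matrix $A$ with error $\delta$ if $\Pr_{B\sim\mathcal M}[A[i,j]=B[i,j]]\ge 1-\delta$ for every entry $(i,j)$, and its rank is the maximum rank of a matrix in its support. The $\delta$-probabilistic rank of $A$ is the minimum rank of a probabilistic matrix computing $A$ with error $\delta$. The Walsh-Hadamard matrix $H_n$ is the $2^n\times 2^n$ matrix with rows and columns indexed by $\{0,1\}^n$ and entries $H_n(x,y)=(-1)^{\langle x,y\rangle}$, where $\langle x,y\rangle=\sum_k x_ky_k$. There are absolute constants $c,C,\varepsilon_0>0$ such that for every field $K$ and every $\varepsilon$ with $0<\varepsilon<\varepsilon_0$: 1. for every integer $n\ge 0$, the $\frac{1}{2^{n(1-\varepsilon)}}$-probabilistic rank of $H_n$ over $K$ is at most $2^{\,n-c\,\frac{\varepsilon^2}{\log(1/\varepsilon)}\,n}$; and 2. for every integer $n\ge 2$, the $\varepsilon$-probabilistic rank of $H_n$ over $K$ is at most $(1/\varepsilon)^{C\sqrt n\,\log n}$. -/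

import Mathlib

/-- A probabilistic matrix over `R`: a (discrete) probability distribution on matrices over `R`. -/
abbrev ProbabilisticMatrix (m n R : Type*) := PMF (Matrix m n R)

namespace ProbabilisticMatrix

variable {m n R : Type*}

/-- `𝓜` computes `A` with error `ε`: for every entry `(i, j)`,
`Pr_{B ∼ 𝓜} [A[i, j] = B[i, j]] ≥ 1 - ε`. -/
def Computes (𝓜 : ProbabilisticMatrix m n R) (A : Matrix m n R) (ε : ℝ) : Prop :=
  ∀ i j, 1 - ε ≤ (PMF.toOuterMeasure 𝓜 {B : Matrix m n R | A i j = B i j}).toReal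

/-- The rank of a probabilistic matrix: the maximum rank of a matrix in its support
(ranks are at most the number of columns, so this supremum is a maximum). -/
noncomputable def rank [Fintype n] [CommRing R] (𝓜 : ProbabilisticMatrix m n R) : ℕ :=
  sSup (Matrix.rank '' (PMF.support 𝓜))

end ProbabilisticMatrix

/-- The `ε`-probabilistic rank of `A`: the minimum rank of a probabilistic matrix computing `A`
with error `ε` (for `ε ≥ 0` the point distribution at `A` is one, so the minimum exists). -/
noncomputable def probabilisticRank {m n R : Type*} [Fintype n] [CommRing R]
    (A : Matrix m n R) (ε : ℝ) : ℕ :=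
  sInf {r : ℕ | ∃ 𝓜 : ProbabilisticMatrix m n R, 𝓜.Computes A ε ∧ 𝓜.rank = r}

/-- The Walsh-Hadamard matrix `H_n` over `K`, with entries `(-1) ^ ⟨x, y⟩`. Rows and columns are
indexed by the vectors of `{0,1}^n` themselves; their order does not affect (probabilistic) rank. -/
def walshHadamard (K : Type*) [Ring K] (n : ℕ) : Matrix (Fin n → Fin 2) (Fin n → Fin 2) K :=
  fun x y => (-1 : K) ^ (∑ k, (x k : ℕ) * (y k : ℕ))

/-! Since `H(x, y + b) = H(x, y) H(x, b)`, a fixed matrix with few wrong entries in every row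
becomes a probabilistic one of no larger rank: translate the columns by a random `b` and correct the
signs (`probabilisticRank_le_of_card_ne`). Both bounds thus reduce to fixed matrices.

Second bound: `H(x, y)` is `(-1) ^ j`, with `j` the size of the common support. For most `y`, `j`
lies within `O(√(n log(1/ε)))` of half the weight of `x`, and on such a window `(-1) ^ j` is a
combination of low binomials `j.choose l`, hence a sum over small sets `T` of products of a function
of `x` and one of `y`.

First bound: if `2 ≠ 0`, then `H_k ^ 2 = 2 ^ k` for even `k` gives `H_k = s (Q - P)` with `P + Q =
1` and both ranks at most half. Expand the `m`-fold Kronecker power over the set `V` of factors `P`,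
with sign `(-1) ^ #V`. Replacing the sign by a polynomial in `#V` of degree at most `t` gives a
matrix supported on pairs differing in at most `t` blocks, because `P + Q = 1`. Subtracting it kills
all `V` of typical size, and Chernoff bounds the rest (`exists_block_approximation`). Blocks of size
about `4 log(1/ε)` and `t ≈ εm/8` balance error and rank. Small `n` needs only a constant-factor
saving, and in characteristic 2 the matrix has rank one. -/

section WalshHadamardRank

open Finset

/-! ### Rank inequalities and factorizations -/

namespace Matrix

variable {K : Type*} [Field K]

theorem rank_add_le {m n : Type*} [Finite m] [Fintype n] (A B : Matrix m n K) :
    (A + B).rank ≤ A.rank + B.rank := by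
  have := Fintype.ofFinite m
  unfold Matrix.rank
  rw [mulVecLin_add]
  refine (Submodule.finrank_mono (LinearMap.range_add_le _ _)).trans ?_
  exact Submodule.finrank_add_le_finrank_add_finrank _ _

theorem rank_sum_le {m n ι : Type*} [Finite m] [Fintype n] (s : Finset ι) (A : ι → Matrix m n K) :
    (∑ i ∈ s, A i).rank ≤ ∑ i ∈ s, (A i).rank := by
  classical
  induction s using Finset.induction_on with
  | empty => simp
  | insert i s hi ih =>
    rw [sum_insert hi, sum_insert hi]
    exact (rank_add_le _ _).trans (Nat.add_le_add_left ih _)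

theorem exists_eq_mul_of_rank {m n : Type*} [Finite m] [Fintype n] (A : Matrix m n K) :
    ∃ (B : Matrix m (Fin A.rank) K) (C : Matrix (Fin A.rank) n K), A = B * C := by
  classical
  have := Fintype.ofFinite m
  let b : Module.Basis (Fin A.rank) K (LinearMap.range A.mulVecLin) := Module.finBasis K _
  have hmem (j : n) : A.mulVecLin (Pi.single j 1) ∈ LinearMap.range A.mulVecLin := ⟨_, rfl⟩
  refine ⟨of fun i k => (b k : m → K) i, of fun k j => b.repr ⟨_, hmem j⟩ k, ?_⟩
  ext i j
  have h := congrArg (fun v : LinearMap.range A.mulVecLin => (v : m → K) i)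
    (b.sum_repr ⟨_, hmem j⟩)
  simp only [mulVecLin_apply, mulVec_single_one, Submodule.coe_sum, Submodule.coe_smul,
    Finset.sum_apply, Pi.smul_apply, smul_eq_mul] at h
  refine h.symm.trans ?_
  simp only [mul_apply, of_apply, mulVecLin_apply, mulVec_single_one]
  exact sum_congr rfl fun k _ => mul_comm _ _

theorem rank_le_of_eq_sum {m n γ : Type*} [Finite m] [Fintype n] [Fintype γ] (A : Matrix m n K)
    (B : m → γ → K) (C : γ → n → K) (h : ∀ x y, A x y = ∑ g, B x g * C g y) :
    A.rank ≤ Fintype.card γ := by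
  have : A = (of B) * (of C) := by
    ext x y
    simp [mul_apply, h]
  rw [this]
  exact (rank_mul_le_left _ _).trans (rank_le_card_width _)

theorem rank_smul_le {m n : Type*} [Finite m] [Fintype n] (c : K) (A : Matrix m n K) :
    (c • A).rank ≤ A.rank := by
  classical
  have : c • A = A * (c • (1 : Matrix n n K)) := by simp
  rw [this]
  exact rank_mul_le_left _ _

end Matrix

/-! ### Interpolation of signs and Chernoff's bound -/

/-- Binomial interpolation of `(-1) ^ j` on an interval of length `t`. -/
theorem exists_choose_interpolation (R : Type*) [CommRing R] (a t : ℕ) :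
    ∃ c : ℕ → R, ∀ j, a ≤ j → j ≤ a + t →
      ∑ l ∈ range (t + 1), c l * (j.choose l : R) = (-1) ^ j := by
  suffices h : ∃ c : ℕ → ℤ, ∀ j, a ≤ j → j ≤ a + t →
      ∑ l ∈ range (t + 1), c l * (j.choose l : ℤ) = (-1) ^ j by
    obtain ⟨c, hc⟩ := h
    refine ⟨fun l => (c l : R), fun j h1 h2 => ?_⟩
    have := congrArg (Int.cast : ℤ → R) (hc j h1 h2)
    push_cast at this
    exact this
  suffices h : ∀ a : ℕ, ∀ f : ℕ → ℤ, ∃ c : ℕ → ℤ, ∀ j, a ≤ j →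
      ∑ l ∈ range (t + 1), c l * (j.choose l : ℤ) =
        ∑ l ∈ range (t + 1), f l * ((j - a).choose l : ℤ) by
    -- This is `(1 - 2) ^ (j - a)` expanded binomially, exact when `j - a ≤ t`. Working over `ℤ`
    -- avoids division, so the result passes to every characteristic.
    obtain ⟨c, hc⟩ := h a (fun l => (-1) ^ a * (-2) ^ l)
    refine ⟨c, fun j h1 h2 => ?_⟩
    rw [hc j h1]
    obtain ⟨i, rfl⟩ := Nat.exists_eq_add_of_le h1
    have h3 : range (i + 1) ⊆ range (t + 1) := range_subset_range.2 (by omega)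
    rw [Nat.add_sub_cancel_left, ← sum_subset h3]
    · have := add_pow (-2 : ℤ) 1 i
      simp only [one_pow, mul_one] at this
      simp only [mul_assoc, ← mul_sum]
      rw [← this, pow_add]
      norm_num
    · intro l _ hl
      rw [Nat.choose_eq_zero_of_lt (by simpa using hl)]
      simp
  intro a
  induction a with
  | zero => exact fun f => ⟨f, fun j _ => by simp⟩
  | succ a ih =>
    intro f
    have hstep : ∀ T : ℕ, ∀ f : ℕ → ℤ, ∃ g : ℕ → ℤ, ∀ i,
        ∑ l ∈ range (T + 1), f l * (i.choose l : ℤ) =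
          ∑ l ∈ range (T + 1), g l * ((i + 1).choose l : ℤ) := by
      intro T
      induction T with
      | zero => exact fun f => ⟨f, fun i => by simp⟩
      | succ T ihT =>
        intro f
        -- Pascal's rule: `i.choose (T + 1) = (i + 1).choose (T + 1) - i.choose T`, so the top
        -- coefficient is subtracted from the next one.
        obtain ⟨g, hg⟩ := ihT (fun l => if l = T then f T - f (T + 1) else f l)
        refine ⟨fun l => if l = T + 1 then f (T + 1) else g l, fun i => ?_⟩
        rw [sum_range_succ, sum_range_succ _ (T + 1)]
        have e1 : ∑ x ∈ range (T + 1), (if x = T + 1 then f (T + 1) else g x) *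
            ((i + 1).choose x : ℤ) = ∑ x ∈ range (T + 1), g x * ((i + 1).choose x : ℤ) :=
          sum_congr rfl fun x hx => by rw [if_neg (by simp at hx; omega)]
        rw [e1, ← hg i, sum_range_succ, sum_range_succ _ T]
        have e2 : ∑ x ∈ range T, (if x = T then f T - f (T + 1) else f x) * (i.choose x : ℤ) =
            ∑ x ∈ range T, f x * (i.choose x : ℤ) :=
          sum_congr rfl fun x hx => by rw [if_neg (by simp at hx; omega)]
        simp only [e2, ↓reduceIte]
        rw [Nat.choose_succ_succ]
        push_cast
        ring
    obtain ⟨g, hg⟩ := hstep t f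
    obtain ⟨c, hc⟩ := ih g
    refine ⟨c, fun j hj => ?_⟩
    rw [hc j (by omega), hg, show j - (a + 1) + 1 = j - a by omega]

/-- The sum factors over coordinates: those in `s` contribute `2 cosh z ≤ 2 exp (z ^ 2 / 2)`, the
others `2`. -/
theorem sum_exp_signs_le {ι : Type*} [Fintype ι] [DecidableEq ι] (s : Finset ι) (z : ℝ) :
    ∑ V : Finset ι, Real.exp (z * ((#s : ℝ) - 2 * #(s ∩ V))) ≤
      2 ^ Fintype.card ι * Real.exp (Fintype.card ι * (z ^ 2 / 2)) := by
  have h1 (V : Finset ι) : Real.exp (z * ((#s : ℝ) - 2 * #(s ∩ V))) =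
      (∏ i ∈ V, if i ∈ s then Real.exp (-z) else 1) *
        ∏ i ∈ Vᶜ, if i ∈ s then Real.exp z else 1 := by
    rw [← prod_filter, ← prod_filter, prod_const, prod_const, ← Real.exp_nat_mul,
      ← Real.exp_nat_mul, ← Real.exp_add]
    have hA : V.filter (· ∈ s) = s ∩ V := by ext; simp [and_comm]
    have hB : (Vᶜ).filter (· ∈ s) = s \ V := by ext; simp [and_comm]
    have hC := card_inter_add_card_sdiff s V
    rw [hA, hB, ← hC]
    push_cast
    ring_nf
  simp_rw [h1]
  rw [← Fintype.prod_add]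
  calc _ ≤ ∏ _i : ι, (2 * Real.exp (z ^ 2 / 2)) := by
        refine prod_le_prod (fun i _ => by positivity) fun i _ => ?_
        split_ifs
        · have := Real.cosh_le_exp_half_sq z
          rw [Real.cosh_eq] at this
          linarith
        · have : 1 ≤ Real.exp (z ^ 2 / 2) := Real.one_le_exp (by positivity)
          linarith
    _ = _ := by
        rw [prod_const, mul_pow, ← Real.exp_nat_mul, card_univ]

/-- Chernoff's bound for the number of elements of `s` in a random subset. -/
theorem card_deviation_le {ι : Type*} [Fintype ι] [DecidableEq ι] (s : Finset ι) (T : ℝ)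
    (hT : 0 ≤ T) (hι : 0 < Fintype.card ι) :
    (#{V : Finset ι | T ≤ |(#s : ℝ) - 2 * #(s ∩ V)|} : ℝ) ≤
      2 * 2 ^ Fintype.card ι * Real.exp (-(T ^ 2 / (2 * (Fintype.card ι : ℝ)))) := by
  set n : ℝ := (Fintype.card ι : ℝ) with hn
  have hn0 : 0 < n := by rw [hn]; exact_mod_cast hι
  -- Minimizes `n z ^ 2 / 2 - z T`.
  set z := T / n
  have hz : 0 ≤ z := by positivity
  have key : (#{V : Finset ι | T ≤ |(#s : ℝ) - 2 * #(s ∩ V)|} : ℝ) * Real.exp (z * T) ≤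
      2 * (2 ^ Fintype.card ι * Real.exp (n * (z ^ 2 / 2))) := by
    have h1 := sum_exp_signs_le s z
    have h2 := sum_exp_signs_le s (-z)
    rw [neg_sq] at h2
    calc _ = ∑ V : Finset ι with T ≤ |(#s : ℝ) - 2 * #(s ∩ V)|, Real.exp (z * T) := by
          rw [sum_const, nsmul_eq_mul]
      _ ≤ ∑ V : Finset ι with T ≤ |(#s : ℝ) - 2 * #(s ∩ V)|,
          (Real.exp (z * ((#s : ℝ) - 2 * #(s ∩ V))) +
            Real.exp (-z * ((#s : ℝ) - 2 * #(s ∩ V)))) := by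
          refine sum_le_sum fun V hV => ?_
          rw [mem_filter] at hV
          rcases le_abs.1 hV.2 with h | h
          · exact (Real.exp_le_exp.2 (mul_le_mul_of_nonneg_left h hz)).trans
              (le_add_of_nonneg_right (Real.exp_pos _).le)
          · refine le_trans (Real.exp_le_exp.2 ?_)
              (le_add_of_nonneg_left (Real.exp_pos _).le)
            rw [neg_mul, ← mul_neg]
            exact mul_le_mul_of_nonneg_left h hz
      _ ≤ ∑ V : Finset ι, (Real.exp (z * ((#s : ℝ) - 2 * #(s ∩ V))) +
            Real.exp (-z * ((#s : ℝ) - 2 * #(s ∩ V)))) :=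
          sum_le_sum_of_subset_of_nonneg (subset_univ _) fun _ _ _ => by positivity
      _ ≤ _ := by rw [sum_add_distrib]; linarith
  rw [← le_div_iff₀ (Real.exp_pos _), mul_div_assoc, mul_div_assoc, ← Real.exp_sub] at key
  refine key.trans (le_of_eq ?_)
  rw [mul_assoc]
  congr 4
  simp only [z]
  field_simp
  ring

namespace ProbabilisticMatrix

theorem rank_le {m n K : Type*} [Fintype n] [CommRing K] (𝓜 : ProbabilisticMatrix m n K) (r : ℕ)
    (h : ∀ B ∈ PMF.support 𝓜, Matrix.rank B ≤ r) : 𝓜.rank ≤ r := by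
  refine csSup_le (𝓜.support_nonempty.image _) ?_
  rintro _ ⟨B, hB, rfl⟩
  exact h B hB

end ProbabilisticMatrix

/-! ### Sign matrices and random translations -/

section signs

variable (K : Type*) [Field K]

/-- The Walsh-Hadamard matrix over an arbitrary finite set of coordinates. -/
def signMatrix (ι : Type*) [Fintype ι] : Matrix (ι → Fin 2) (ι → Fin 2) K :=
  fun x y => ∏ i, (-1 : K) ^ ((x i : ℕ) * (y i : ℕ))

theorem walshHadamard_eq_signMatrix (n : ℕ) : walshHadamard K n = signMatrix K (Fin n) := by
  ext x y
  exact (prod_pow_eq_pow_sum _ _ _).symm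

variable {ι : Type*} [Fintype ι]

theorem signMatrix_comm (x y : ι → Fin 2) : signMatrix K ι x y = signMatrix K ι y x := by
  simp only [signMatrix, mul_comm]

theorem signMatrix_add (x y z : ι → Fin 2) :
    signMatrix K ι x (y + z) = signMatrix K ι x y * signMatrix K ι x z := by
  simp only [signMatrix, ← prod_mul_distrib]
  refine prod_congr rfl fun i _ => ?_
  rw [Pi.add_apply]
  generalize x i = a
  generalize y i = b
  generalize z i = c
  fin_cases a <;> fin_cases b <;> fin_cases c <;> simp

theorem signMatrix_mul_self (x y : ι → Fin 2) :
    signMatrix K ι x y * signMatrix K ι x y = 1 := by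
  simp only [signMatrix, ← prod_mul_distrib]
  refine prod_eq_one fun i _ => ?_
  rw [← mul_pow]
  simp

theorem signMatrix_mul [DecidableEq ι] : signMatrix K ι * signMatrix K ι =
    (2 : K) ^ Fintype.card ι • (1 : Matrix (ι → Fin 2) (ι → Fin 2) K) := by
  ext x z
  rw [Matrix.mul_apply]
  simp only [signMatrix, ← prod_mul_distrib]
  rw [← Fintype.prod_sum (fun i (b : Fin 2) =>
    (-1 : K) ^ ((x i : ℕ) * (b : ℕ)) * (-1 : K) ^ ((b : ℕ) * (z i : ℕ)))]
  have h (i : ι) : ∑ b : Fin 2, (-1 : K) ^ ((x i : ℕ) * (b : ℕ)) * (-1 : K) ^ ((b : ℕ) * (z i : ℕ))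
      = if x i = z i then 2 else 0 := by
    generalize x i = a
    generalize z i = c
    fin_cases a <;> fin_cases c <;> norm_num
  simp only [h]
  rw [Matrix.smul_apply, Matrix.one_apply]
  by_cases hxz : x = z
  · simp [hxz]
  · obtain ⟨i, hi⟩ := Function.ne_iff.1 hxz
    rw [if_neg hxz, prod_eq_zero (mem_univ i) (if_neg hi)]
    simp

open Classical in
/-- A matrix that agrees with the Walsh-Hadamard matrix on all but a `δ` fraction of each row
gives, by random translations of the columns, a probabilistic matrix of the same rank. -/
theorem probabilisticRank_le_of_card_ne {n : ℕ} (B : Matrix (Fin n → Fin 2) (Fin n → Fin 2) K)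
    (δ : ℝ) (h : ∀ x, (#{y | B x y ≠ walshHadamard K n x y} : ℝ) ≤ δ * 2 ^ n) :
    probabilisticRank (walshHadamard K n) δ ≤ B.rank := by
  let f (b : Fin n → Fin 2) : Matrix (Fin n → Fin 2) (Fin n → Fin 2) K :=
    Matrix.of fun x y => B x (y + b) * walshHadamard K n x b
  let 𝓜 : ProbabilisticMatrix (Fin n → Fin 2) (Fin n → Fin 2) K :=
    (PMF.uniformOfFintype (Fin n → Fin 2)).map f
  have hrank : 𝓜.rank ≤ B.rank := by
    refine 𝓜.rank_le _ fun M hM => ?_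
    simp only [𝓜, PMF.support_map, PMF.support_uniformOfFintype] at hM
    obtain ⟨b, -, rfl⟩ := hM
    have : f b = Matrix.diagonal (fun x => walshHadamard K n x b) *
        B.submatrix (Equiv.refl _) (Equiv.addRight b) := by
      ext x y
      simp [f, Matrix.diagonal_mul, mul_comm]
    rw [this]
    exact (Matrix.rank_mul_le_right _ _).trans (Matrix.rank_submatrix _ _ _).le
  refine le_trans (Nat.sInf_le ⟨𝓜, fun x y => ?_, rfl⟩) hrank
  rw [PMF.toOuterMeasure_map_apply, PMF.toOuterMeasure_uniformOfFintype_apply]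
  have hcompl : #{b | ¬ walshHadamard K n x y = f b x y} ≤
      #{y | B x y ≠ walshHadamard K n x y} := by
    refine card_le_card_of_injOn (fun b => y + b) (fun b hb => ?_)
      (add_right_injective y).injOn
    have hb' := (mem_filter.1 (mem_coe.1 hb)).2
    refine mem_coe.2 (mem_filter.2 ⟨mem_univ _, fun he => hb' ?_⟩)
    change walshHadamard K n x y = B x (y + b) * walshHadamard K n x b
    rw [he, walshHadamard_eq_signMatrix, signMatrix_add, mul_assoc, signMatrix_mul_self, mul_one]
  have hsum := card_filter_add_card_filter_not (s := univ)
    (fun b => walshHadamard K n x y = f b x y)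
  have hcard : #(univ : Finset (Fin n → Fin 2)) = 2 ^ n := by simp
  rw [hcard] at hsum
  have hs : Fintype.card ↑(f ⁻¹' {B | walshHadamard K n x y = B x y}) =
      #{b | walshHadamard K n x y = f b x y} := by
    rw [← Set.toFinset_card]
    congr 1
    ext b
    simp
  rw [hs]
  have h2 : (0 : ℝ) < 2 ^ n := by positivity
  have hc : (#{b | ¬ walshHadamard K n x y = f b x y} : ℝ) ≤ δ * 2 ^ n :=
    le_trans (by exact_mod_cast hcompl) (h x)
  have hsum' : (#{b | walshHadamard K n x y = f b x y} : ℝ) +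
      (#{b | ¬ walshHadamard K n x y = f b x y} : ℝ) = 2 ^ n := by exact_mod_cast hsum
  simp only [ENNReal.toReal_div, ENNReal.toReal_natCast, Fintype.card_pi, Fintype.card_fin,
    prod_const, card_univ]
  push_cast
  rw [le_div_iff₀ h2]
  linarith

end signs

/-! ### Low-degree approximation of rows: the second bound -/

section symmetric

variable (K : Type*) [Field K]

/-- The set of coordinates at which a binary vector is `1`. -/
def oneSet {ι : Type*} [Fintype ι] (x : ι → Fin 2) : Finset ι := {i | x i = 1}

theorem oneSet_injective {ι : Type*} [Fintype ι] :
    Function.Injective (oneSet : (ι → Fin 2) → Finset ι) := by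
  intro x y h
  ext i
  have := congrArg (i ∈ ·) h
  simp only [oneSet, mem_filter, mem_univ, true_and, eq_iff_iff] at this
  generalize x i = a at *
  generalize y i = b at *
  fin_cases a <;> fin_cases b <;> simp_all

theorem walshHadamard_apply (n : ℕ) (x y : Fin n → Fin 2) :
    walshHadamard K n x y = (-1) ^ #(oneSet x ∩ oneSet y) := by
  rw [walshHadamard, card_eq_sum_ones, oneSet, oneSet, ← filter_and, sum_filter]
  congr 1
  refine sum_congr rfl fun i _ => ?_
  generalize x i = a
  generalize y i = b
  fin_cases a <;> fin_cases b <;> simp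

/-- `(#S).choose l` counts the `l`-subsets of `S`. For `S` an intersection, the condition `T ⊆ S`
splits into one condition on each set, which yields low rank. -/
theorem sum_card_le_eq_sum_choose {ι R : Type*} [Fintype ι] [DecidableEq ι] [CommRing R]
    (S : Finset ι) (c : ℕ → R) (t : ℕ) :
    ∑ T : Finset ι with #T ≤ t, (if T ⊆ S then c #T else 0) =
      ∑ l ∈ range (t + 1), c l * ((#S).choose l : R) := by
  rw [← sum_fiberwise_of_maps_to (t := range (t + 1)) (g := card)
    (fun T hT => by simp only [mem_filter] at hT; simpa using by omega)]
  refine sum_congr rfl fun l hl => ?_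
  have hl' : l ≤ t := by simpa [Nat.lt_succ_iff] using hl
  rw [← sum_filter, ← card_powersetCard, mul_comm, ← nsmul_eq_mul, ← sum_const]
  refine sum_congr ?_ fun T hT => by rw [(mem_powersetCard.1 hT).2]
  ext T
  simp only [mem_filter, mem_univ, true_and, mem_powersetCard]
  constructor
  · rintro ⟨⟨-, h1⟩, h2⟩; exact ⟨h2, h1⟩
  · rintro ⟨h1, h2⟩; exact ⟨⟨by omega, h2⟩, h1⟩

theorem card_card_le_le (n t : ℕ) (hn : 2 ≤ n) :
    #{T : Finset (Fin n) | #T ≤ t} ≤ n ^ (t + 1) := by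
  rw [card_eq_sum_card_fiberwise (t := range (t + 1)) (f := card)
    (fun T hT => by
      have := (mem_filter.1 (mem_coe.1 hT)).2
      simpa using by omega)]
  refine le_trans (sum_le_sum fun l hl => ?_)
    (Nat.geomSum_lt hn (s := range (t + 1)) (fun k hk => by simpa using hk)).le
  refine le_trans (card_le_card (t := powersetCard l univ) fun T hT => ?_) ?_
  · simp only [mem_filter] at hT
    exact mem_powersetCard.2 ⟨subset_univ _, hT.2⟩
  · rw [card_powersetCard, card_univ, Fintype.card_fin]
    exact Nat.choose_le_pow n l

theorem exists_interval_interpolation (R : Type*) [CommRing R] (w t : ℕ) :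
    ∃ c : ℕ → R, ∀ j ≤ w, |(w : ℝ) - 2 * j| < t →
      ∑ l ∈ range (t + 1), c l * (j.choose l : R) = (-1) ^ j := by
  obtain ⟨c, hc⟩ := exists_choose_interpolation R ((w - t) / 2) t
  refine ⟨c, fun j hj h => ?_⟩
  rw [abs_lt] at h
  have h1 : (w : ℝ) < 2 * j + t := by linarith
  have h2 : (2 * j : ℝ) < w + t := by linarith
  norm_cast at h1 h2
  exact hc j (by omega) (by omega)

theorem probabilisticRank_walshHadamard_le_pow (n t : ℕ) (hn : 2 ≤ n) (δ : ℝ)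
    (hδ : 2 * Real.exp (-((t : ℝ) ^ 2 / (2 * n))) ≤ δ) :
    probabilisticRank (walshHadamard K n) δ ≤ n ^ (t + 1) := by
  classical
  choose c hc using fun w => exists_interval_interpolation K w t
  -- The coefficients may depend on the weight of `x`, since they belong to the row factor.
  let B : Matrix (Fin n → Fin 2) (Fin n → Fin 2) K := Matrix.of fun x y =>
    ∑ T : Finset (Fin n) with #T ≤ t,
      (if T ⊆ oneSet x then c #(oneSet x) #T else 0) * (if T ⊆ oneSet y then 1 else 0)
  have hB (x y) : B x y =
      ∑ l ∈ range (t + 1), c #(oneSet x) l * ((#(oneSet x ∩ oneSet y)).choose l : K) := by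
    rw [← sum_card_le_eq_sum_choose]
    simp only [B, Matrix.of_apply]
    refine sum_congr rfl fun T _ => ?_
    simp only [subset_inter_iff]
    split_ifs <;> simp_all
  refine (probabilisticRank_le_of_card_ne K B δ fun x => ?_).trans ?_
  · have hle : #{y | B x y ≠ walshHadamard K n x y} ≤
        #{V : Finset (Fin n) | (t : ℝ) ≤ |(#(oneSet x) : ℝ) - 2 * #(oneSet x ∩ V)|} := by
      refine card_le_card_of_injOn oneSet (fun y hy => ?_) oneSet_injective.injOn
      refine mem_coe.2 (mem_filter.2 ⟨mem_univ _, ?_⟩)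
      by_contra hlt
      refine (mem_filter.1 (mem_coe.1 hy)).2 ?_
      rw [hB, walshHadamard_apply]
      exact hc _ _ (card_le_card inter_subset_left) (not_le.1 hlt)
    have hdev := card_deviation_le (oneSet x) t (by positivity) (by rw [Fintype.card_fin]; omega)
    rw [Fintype.card_fin] at hdev
    calc (#{y | B x y ≠ walshHadamard K n x y} : ℝ) ≤ _ := by exact_mod_cast hle
      _ ≤ _ := hdev
      _ = 2 * Real.exp (-((t : ℝ) ^ 2 / (2 * n))) * 2 ^ n := by ring
      _ ≤ _ := by gcongr
  · refine (B.rank_le_of_eq_sum (γ := {T : Finset (Fin n) // #T ≤ t})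
      (fun x T => if T.1 ⊆ oneSet x then c #(oneSet x) #T.1 else 0)
      (fun T y => if T.1 ⊆ oneSet y then 1 else 0) fun x y => ?_).trans ?_
    · simp only [B, Matrix.of_apply]
      exact (sum_subtype _ (fun T => by simp) _)
    · rw [Fintype.card_subtype]
      exact card_card_le_le n t hn

theorem probabilisticRank_walshHadamard_le_rpow (ε : ℝ) (hε : 0 < ε) (hε' : ε < Real.exp (-1))
    (n : ℕ) (hn : 2 ≤ n) :
    (probabilisticRank (walshHadamard K n) ε : ℝ) ≤
      (1 / ε) ^ (4 * (Real.sqrt n * Real.log n)) := by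
  set L := Real.log (1 / ε) with hL
  have hεL : ε = Real.exp (-L) := by
    rw [hL, one_div, Real.log_inv, neg_neg, Real.exp_log hε]
  have hL1 : 1 ≤ L := by
    rw [hεL, Real.exp_lt_exp] at hε'
    linarith
  have hs : 1 ≤ Real.sqrt n := Real.one_le_sqrt.2 (by exact_mod_cast (by omega : 1 ≤ n))
  have hn0 : (0 : ℝ) < n := by exact_mod_cast (by omega : 0 < n)
  have hsq : Real.sqrt n ^ 2 = n := Real.sq_sqrt hn0.le
  -- Then `t ^ 2 / (2n) ≥ 2L`, and one factor `exp (-L)` absorbs the constant 2 of Chernoff's bound.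
  set t := ⌈2 * Real.sqrt n * L⌉₊ with ht
  have ht1 : 2 * Real.sqrt n * L ≤ t := Nat.le_ceil _
  have ht2 : (t : ℝ) < 2 * Real.sqrt n * L + 1 := Nat.ceil_lt_add_one (by positivity)
  have hsL : 1 ≤ Real.sqrt n * L := by nlinarith
  have hδ : 2 * Real.exp (-((t : ℝ) ^ 2 / (2 * n))) ≤ ε := by
    have h1 : 2 * L ≤ (t : ℝ) ^ 2 / (2 * n) := by
      rw [le_div_iff₀ (by positivity), ← hsq]
      have : (2 * Real.sqrt n * L) ^ 2 ≤ (t : ℝ) ^ 2 := by gcongr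
      nlinarith [mul_nonneg (sq_nonneg (Real.sqrt n)) (by nlinarith : 0 ≤ L ^ 2 - L)]
    have h2 : (2 : ℝ) ≤ Real.exp L := by linarith [Real.add_one_le_exp L]
    calc 2 * Real.exp (-((t : ℝ) ^ 2 / (2 * n))) ≤ Real.exp L * Real.exp (-(2 * L)) := by
          gcongr
      _ = ε := by rw [← Real.exp_add, hεL]; congr 1; ring
  refine le_trans (Nat.cast_le.2 (probabilisticRank_walshHadamard_le_pow K n t hn ε hδ)) ?_
  have hlog : 0 ≤ Real.log n := Real.log_natCast_nonneg n
  rw [Real.rpow_def_of_pos (by positivity), ← hL]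
  push_cast
  rw [← Real.exp_log hn0, ← Real.exp_nat_mul, Real.exp_le_exp, Real.exp_log hn0]
  push_cast
  nlinarith

end symmetric

/-! ### Scalar shifts of the Walsh-Hadamard matrix -/

section halfRank

variable (K : Type*) [Field K] {ι : Type*} [Fintype ι] [DecidableEq ι]

theorem rank_signMatrix_sub_add_rank_signMatrix_add (σ : K) (hσ : σ * σ = 2 ^ Fintype.card ι) :
    (signMatrix K ι - σ • 1).rank + (signMatrix K ι + σ • 1).rank ≤ 2 ^ Fintype.card ι := by
  have h : (signMatrix K ι - σ • 1) * (signMatrix K ι + σ • 1) = 0 := by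
    rw [mul_add, sub_mul, sub_mul, signMatrix_mul, ← hσ]
    simp only [Matrix.smul_mul, Matrix.mul_smul, one_mul, mul_one, smul_smul]
    abel
  have := Matrix.rank_add_rank_le_card_of_mul_eq_zero h
  simpa using this

theorem signMatrix_single_self (i : ι) :
    signMatrix K ι (Pi.single i 1) (Pi.single i 1) = -1 := by
  rw [signMatrix, Fintype.prod_eq_single i (fun j hj => by simp [hj])]
  simp

/-- Translating by a basis vector and changing signs conjugates the Walsh-Hadamard matrix to its
negative. -/
theorem rank_signMatrix_sub_le (σ : K) (i : ι) :
    (signMatrix K ι - σ • 1).rank ≤ (signMatrix K ι + σ • 1).rank := by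
  set e : ι → Fin 2 := Pi.single i 1
  let D : Matrix (ι → Fin 2) (ι → Fin 2) K := Matrix.diagonal fun x => signMatrix K ι x e
  have h : signMatrix K ι - σ • 1 = (-D) *
      ((signMatrix K ι + σ • 1).submatrix (Equiv.addRight e) (Equiv.addRight e)) * D := by
    ext x y
    have h1 : signMatrix K ι (x + e) (y + e) =
        -(signMatrix K ι x y * signMatrix K ι x e * signMatrix K ι y e) := by
      rw [signMatrix_add, signMatrix_comm K (x + e) y, signMatrix_comm K (x + e) e,
        signMatrix_add, signMatrix_add, signMatrix_single_self, signMatrix_comm K y x,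
        signMatrix_comm K e x]
      ring
    have hx := signMatrix_mul_self K x e
    have hy := signMatrix_mul_self K y e
    simp only [D, Matrix.neg_mul, Matrix.neg_apply, Matrix.mul_diagonal, Matrix.diagonal_mul,
      Matrix.submatrix_apply, Matrix.add_apply, Matrix.sub_apply, Matrix.smul_apply,
      Matrix.one_apply, Equiv.coe_addRight, h1, add_left_inj, smul_eq_mul]
    split_ifs with hxy
    · subst hxy
      linear_combination (-signMatrix K ι x x * (signMatrix K ι x e * signMatrix K ι x e + 1)
        + σ) * hx
    · linear_combination (-signMatrix K ι x y * (signMatrix K ι y e * signMatrix K ι y e)) * hx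
        - signMatrix K ι x y * hy
  rw [h]
  refine (Matrix.rank_mul_le_left _ _).trans ((Matrix.rank_mul_le_right _ _).trans ?_)
  exact (Matrix.rank_submatrix _ _ _).le

/-- The ranks for `σ` and `-σ` add up to at most the dimension, and conjugating by a translation
bounds the first by the second. -/
theorem rank_signMatrix_sub_le_half [Nonempty ι] (σ : K) (hσ : σ * σ = 2 ^ Fintype.card ι) :
    (signMatrix K ι - σ • 1).rank ≤ 2 ^ (Fintype.card ι - 1) := by
  have h1 := rank_signMatrix_sub_add_rank_signMatrix_add K σ hσ
  have h2 := rank_signMatrix_sub_le K σ (Classical.arbitrary ι)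
  have h3 : 2 ^ Fintype.card ι = 2 * 2 ^ (Fintype.card ι - 1) := by
    rw [← pow_succ', Nat.sub_add_cancel Fintype.card_pos]
  omega

end halfRank

/-! ### Kronecker powers and block Hamming distance -/

section blocks

/-- Write the binomials as sums over sets `U ⊆ V` with `#U ≤ t`. For fixed `U` the sum over `V` is
the product of `p i` over `U` and `p i + q i` off `U`; as `U` is too small to contain every zero of
`p + q`, it vanishes. -/
theorem sum_choose_mul_eq_zero {R ι : Type*} [CommRing R] [DecidableEq R] [Fintype ι]
    [DecidableEq ι] (p q : ι → R) (c : ℕ → R) (t : ℕ) (h : t < #{i | p i + q i = 0}) :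
    ∑ V : Finset ι, (∑ l ∈ range (t + 1), c l * ((#V).choose l : R)) *
      ((∏ i ∈ V, p i) * ∏ i ∈ Vᶜ, q i) = 0 := by
  simp_rw [← sum_card_le_eq_sum_choose, sum_mul]
  rw [sum_comm]
  refine sum_eq_zero fun U hU => ?_
  have hU' : #U ≤ t := by simpa using hU
  obtain ⟨i, hi, hiU⟩ := exists_mem_notMem_of_card_lt_card (hU'.trans_lt h)
  have hprod : ∏ j, (p j + if j ∈ U then 0 else q j) = 0 :=
    prod_eq_zero (mem_univ i) (by simpa [hiU] using hi)
  rw [Fintype.prod_add] at hprod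
  refine Eq.trans ?_ ((congrArg (c #U * ·) hprod).trans (mul_zero _))
  simp only [mul_sum]
  refine sum_congr rfl fun V _ => ?_
  split_ifs with hUV
  · congr 2
    refine prod_congr rfl fun j hj => ?_
    rw [if_neg fun hjU => (mem_compl.1 hj) (hUV hjU)]
  · obtain ⟨j, hjU, hjV⟩ := not_subset.1 hUV
    have hz : ∏ a ∈ Vᶜ, (if a ∈ U then 0 else q a) = 0 :=
      prod_eq_zero (mem_compl.2 hjV) (if_pos hjU)
    rw [hz, mul_zero, mul_zero, zero_mul]

variable {K : Type*} [Field K] {α β : Type*} [Fintype α] [Fintype β]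

theorem rank_prod_le {ι : Type*} [Fintype ι] [DecidableEq ι] (M : ι → Matrix α α K)
    (F : Matrix β β K) (r : ℕ) (hM : ∀ i, (M i).rank ≤ r) :
    (Matrix.of fun x y : (ι → α) × β => (∏ i, M i (x.1 i) (y.1 i)) * F x.2 y.2).rank ≤
      r ^ Fintype.card ι * Fintype.card β := by
  classical
  choose B C hBC using fun i => (M i).exists_eq_mul_of_rank
  refine (Matrix.rank_le_of_eq_sum (γ := (∀ i, Fin (M i).rank) × β) _
    (fun x g => (∏ i, B i (x.1 i) (g.1 i)) * if x.2 = g.2 then 1 else 0)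
    (fun g y => (∏ i, C i (g.1 i) (y.1 i)) * F g.2 y.2) fun x y => ?_).trans ?_
  · have h (i : ι) : M i (x.1 i) (y.1 i) = ∑ g, B i (x.1 i) g * C i g (y.1 i) := by
      conv_lhs => rw [hBC i]
      rw [Matrix.mul_apply]
    simp only [Matrix.of_apply, h]
    rw [Fintype.prod_sum, Fintype.sum_prod_type, sum_mul]
    refine sum_congr rfl fun g _ => ?_
    rw [Fintype.sum_eq_single x.2 (fun b hb => by simp [hb.symm])]
    rw [prod_mul_distrib]
    simp
    ring
  · rw [Fintype.card_prod, Fintype.card_pi]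
    refine Nat.mul_le_mul_right _ ?_
    simp only [Fintype.card_fin]
    calc _ ≤ ∏ _i : ι, r := prod_le_prod' fun i _ => hM i
      _ = _ := by rw [prod_const, card_univ]

/-- A Kronecker product of matrices `s (Q - P)` with `P + Q = 1` agrees, off the pairs of
small Hamming distance, with a sum of the Kronecker products of `P` and `Q` in which the number
of factors `P` deviates from its mean. -/
theorem exists_block_approximation [DecidableEq α] (P Q : Matrix α α K) (hPQ : P + Q = 1) (s : K)
    (F : Matrix β β K) (r m t : ℕ) (hP : P.rank ≤ r) (hQ : Q.rank ≤ r) :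
    ∃ B : Matrix ((Fin m → α) × β) ((Fin m → α) × β) K,
      B.rank ≤ #{V : Finset (Fin m) | (t : ℝ) ≤ |(m : ℝ) - 2 * #V|} *
        (r ^ m * Fintype.card β) ∧
      ∀ x y, t < #{i | x.1 i ≠ y.1 i} →
        B x y = (∏ i, (s • (Q - P)) (x.1 i) (y.1 i)) * F x.2 y.2 := by
  classical
  obtain ⟨c, hc⟩ := exists_interval_interpolation K m t
  -- The sign minus its interpolant: zero for typical `#V`, and equivalent to the sign at entries of
  -- block distance above `t`.
  let g (j : ℕ) : K := (-1) ^ j - ∑ l ∈ range (t + 1), c l * (j.choose l : K)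
  let M (V : Finset (Fin m)) : Matrix ((Fin m → α) × β) ((Fin m → α) × β) K :=
    Matrix.of fun x y => (∏ i, (if i ∈ V then P else Q) (x.1 i) (y.1 i)) * F x.2 y.2
  have hM (V x y) : M V x y = ((∏ i ∈ V, P (x.1 i) (y.1 i)) * ∏ i ∈ Vᶜ, Q (x.1 i) (y.1 i)) *
      F x.2 y.2 := by
    simp only [M, Matrix.of_apply]
    rw [← prod_mul_prod_compl V]
    congr 2
    · exact prod_congr rfl fun i hi => by rw [if_pos hi]
    · exact prod_congr rfl fun i hi => by rw [if_neg (mem_compl.1 hi)]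
  have hg (V : Finset (Fin m)) (hV : ¬ (t : ℝ) ≤ |(m : ℝ) - 2 * #V|) : g #V = 0 :=
    sub_eq_zero.2 (hc _ (by simpa using card_le_univ V) (not_le.1 hV)).symm
  refine ⟨∑ V : Finset (Fin m) with (t : ℝ) ≤ |(m : ℝ) - 2 * #V|, (s ^ m * g #V) • M V, ?_,
    fun x y hxy => ?_⟩
  · refine (Matrix.rank_sum_le _ _).trans ?_
    rw [← smul_eq_mul]
    refine sum_le_card_nsmul _ _ _ fun V _ => (Matrix.rank_smul_le _ _).trans ?_
    refine (rank_prod_le (fun i : Fin m => if i ∈ V then P else Q) F r fun i => ?_).trans ?_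
    · split_ifs <;> assumption
    · rw [Fintype.card_fin]
  · rw [sum_filter_of_ne fun V _ hV => by
      by_contra hlt
      exact hV (by rw [hg V hlt, mul_zero, zero_smul])]
    have h0 := sum_choose_mul_eq_zero (fun i => P (x.1 i) (y.1 i)) (fun i => Q (x.1 i) (y.1 i))
      c t (hxy.trans_le (card_le_card fun i hi => by
        have hi' := (mem_filter.1 hi).2
        refine mem_filter.2 ⟨mem_univ _, ?_⟩
        rw [← Matrix.add_apply, hPQ, Matrix.one_apply_ne hi']))
    have h1 := Fintype.prod_add (fun i => -P (x.1 i) (y.1 i)) (fun i => Q (x.1 i) (y.1 i))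
    have h2 : ∏ i, (s • (Q - P)) (x.1 i) (y.1 i) =
        s ^ m * ∏ i, (-P (x.1 i) (y.1 i) + Q (x.1 i) (y.1 i)) := by
      simp only [Matrix.smul_apply, Matrix.sub_apply, smul_eq_mul, prod_mul_distrib, prod_const,
        card_univ, Fintype.card_fin]
      simp only [sub_eq_neg_add]
    rw [h2, h1, Matrix.sum_apply]
    simp only [Matrix.smul_apply, smul_eq_mul, hM, g]
    rw [mul_sum, sum_mul, ← sub_eq_zero, ← sum_sub_distrib]
    refine Eq.trans (sum_congr rfl fun V _ => ?_)
      ((mul_sum _ _ (-(s ^ m * F x.2 y.2))).symm.trans (by rw [h0, mul_zero]))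
    rw [prod_neg]
    ring

/-- Weighting each `y` by `z` to its distance from `x` makes the sum a product of factors at most `1
+ z * card α`. -/
theorem card_hamming_ball_mul_le {ι : Type*} [Fintype ι] [DecidableEq ι] [DecidableEq α]
    (x : ι → α) (t : ℕ) (z : ℝ) (hz : 0 < z) (hz1 : z ≤ 1) :
    (#{y : ι → α | #{i | x i ≠ y i} ≤ t} : ℝ) * z ^ t ≤
      Real.exp (Fintype.card ι * (z * Fintype.card α)) := by
  calc (#{y : ι → α | #{i | x i ≠ y i} ≤ t} : ℝ) * z ^ t
      = ∑ y : ι → α with #{i | x i ≠ y i} ≤ t, z ^ t := by rw [sum_const, nsmul_eq_mul]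
    _ ≤ ∑ y : ι → α with #{i | x i ≠ y i} ≤ t, z ^ #{i | x i ≠ y i} :=
        sum_le_sum fun y hy => pow_le_pow_of_le_one hz.le hz1 (mem_filter.1 hy).2
    _ ≤ ∑ y : ι → α, z ^ #{i | x i ≠ y i} :=
        sum_le_sum_of_subset_of_nonneg (subset_univ _) fun _ _ _ => by positivity
    _ = ∑ y : ι → α, ∏ i, if x i ≠ y i then z else 1 := by
        refine sum_congr rfl fun y _ => ?_
        rw [← prod_filter, prod_const]
    _ = ∏ i, ∑ b : α, if x i ≠ b then z else 1 :=
        (Fintype.prod_sum fun i b => if x i ≠ b then z else 1).symm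
    _ ≤ ∏ _i : ι, Real.exp (z * Fintype.card α) := by
        refine prod_le_prod (fun i _ => sum_nonneg fun b _ => by split_ifs <;> positivity)
          fun i _ => ?_
        calc ∑ b : α, (if x i ≠ b then z else 1)
            ≤ ∑ b : α, (z + if b = x i then 1 else 0) := by
              refine sum_le_sum fun b _ => ?_
              by_cases h : x i = b
              · simp [h, hz.le]
              · simp [h]
                split_ifs <;> norm_num
          _ = z * Fintype.card α + 1 := by
              rw [sum_add_distrib]
              simp [mul_comm]
          _ ≤ _ := Real.add_one_le_exp _
    _ = _ := by rw [prod_const, ← Real.exp_nat_mul, card_univ]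

end blocks

/-! ### Matrices of small rank close to the Walsh-Hadamard matrix -/

section constructions

variable (K : Type*) [Field K]

theorem probabilisticRank_le_of_equiv {α : Type*} [Fintype α] [DecidableEq α] {n : ℕ}
    (e : (Fin n → Fin 2) ≃ α) (B : Matrix α α K) (δ : ℝ) (p : α → α → Prop) [DecidableRel p]
    (hB : ∀ x y, ¬ p (e x) (e y) → B (e x) (e y) = walshHadamard K n x y)
    (h : ∀ x, (#{y | p x y} : ℝ) ≤ δ * 2 ^ n) :
    probabilisticRank (walshHadamard K n) δ ≤ B.rank := by
  classical
  rw [← Matrix.rank_submatrix B e e]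
  refine probabilisticRank_le_of_card_ne K _ δ fun x => le_trans ?_ (h (e x))
  refine Nat.cast_le.2 (card_le_card_of_injOn e (fun y hy => ?_) e.injective.injOn)
  have hy' := (mem_filter.1 (mem_coe.1 hy)).2
  refine mem_coe.2 (mem_filter.2 ⟨mem_univ _, ?_⟩)
  by_contra hp
  exact hy' (hB x y hp)

theorem probabilisticRank_walshHadamard_le_two_pow (n : ℕ) (δ : ℝ) (hδ : 0 ≤ δ) :
    probabilisticRank (walshHadamard K n) δ ≤ 2 ^ n := by
  refine (probabilisticRank_le_of_card_ne K (walshHadamard K n) δ fun x => ?_).trans ?_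
  · simp only [ne_eq, not_true_eq_false, filter_false, card_empty, Nat.cast_zero]
    positivity
  · simpa using (walshHadamard K n).rank_le_card_width

theorem probabilisticRank_walshHadamard_le_one_of_two_eq_zero (h2 : (2 : K) = 0) (n : ℕ) (δ : ℝ)
    (hδ : 0 ≤ δ) : probabilisticRank (walshHadamard K n) δ ≤ 1 := by
  have h1 : (-1 : K) = 1 := by linear_combination -h2
  refine (probabilisticRank_le_of_card_ne K (walshHadamard K n) δ fun x => ?_).trans ?_
  · simp only [ne_eq, not_true_eq_false, filter_false, card_empty, Nat.cast_zero]
    positivity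
  · simpa using (walshHadamard K n).rank_le_of_eq_sum (γ := Unit) (fun _ _ => 1) (fun _ _ => 1)
      (fun x y => by simp [walshHadamard, h1])

/-- Choosing the better sign of `2 ^ j` also covers `j = 0` and characteristic 2. -/
theorem exists_rank_signMatrix_sub_le (j : ℕ) :
    ∃ σ : K, 2 * (signMatrix K (Fin (2 * j)) - σ • 1).rank ≤ 2 ^ (2 * j) := by
  have h := rank_signMatrix_sub_add_rank_signMatrix_add K (ι := Fin (2 * j)) (2 ^ j)
    (by rw [Fintype.card_fin, two_mul, pow_add])
  rw [Fintype.card_fin] at h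
  rcases le_total (signMatrix K (Fin (2 * j)) - (2 ^ j : K) • 1).rank
    (signMatrix K (Fin (2 * j)) + (2 ^ j : K) • 1).rank with h' | h'
  · exact ⟨2 ^ j, by omega⟩
  · refine ⟨-2 ^ j, ?_⟩
    rw [neg_smul, sub_neg_eq_add]
    omega

/-- Changing one entry in each row lowers the rank of the Walsh-Hadamard matrix by a constant
factor. -/
theorem probabilisticRank_walshHadamard_le_three_quarters (n : ℕ) (hn : 1 ≤ n) (δ : ℝ)
    (hδ : 1 ≤ δ * 2 ^ n) :
    4 * probabilisticRank (walshHadamard K n) δ ≤ 3 * 2 ^ n := by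
  classical
  rcases Nat.even_or_odd' n with ⟨j, rfl | rfl⟩
  · obtain ⟨σ, hσ⟩ := exists_rank_signMatrix_sub_le K j
    have := probabilisticRank_le_of_equiv K (Equiv.refl (Fin (2 * j) → Fin 2))
      (signMatrix K (Fin (2 * j)) - σ • 1) δ (fun x y => x = y)
      (fun x y hxy => by
        rw [walshHadamard_eq_signMatrix, Matrix.sub_apply, Matrix.smul_apply,
          Matrix.one_apply_ne (by exact hxy)]
        simp)
      (fun x => by
        refine le_trans ?_ hδ
        exact_mod_cast (card_le_card (t := {x}) fun y hy => by
          simp [(mem_filter.1 hy).2]).trans (card_singleton x).le)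
    omega
  · obtain ⟨σ, hσ⟩ := exists_rank_signMatrix_sub_le K j
    set A := signMatrix K (Fin (2 * j)) with hA
    let e : (Fin (2 * j + 1) → Fin 2) ≃ Fin 2 × (Fin (2 * j) → Fin 2) :=
      (Fin.consEquiv fun _ => Fin 2).symm
    -- An odd power of 2 need not be a square in `K`, so one coordinate is split off: `[[A, A], [A,
    -- -A]]` is `[[-A, A], [A, -A]]`, of rank at most half the size, plus `2A` in one corner.
    -- Replacing `A` there by `A - σ` leaves rank at most a quarter.
    let B₁ : Matrix (Fin 2 × (Fin (2 * j) → Fin 2)) (Fin 2 × (Fin (2 * j) → Fin 2)) K :=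
      Matrix.of fun x y => (-1) ^ ((x.1 : ℕ) + y.1 + 1) * A x.2 y.2
    let B₂ : Matrix (Fin 2 × (Fin (2 * j) → Fin 2)) (Fin 2 × (Fin (2 * j) → Fin 2)) K :=
      Matrix.of fun x y => if x.1 = 0 ∧ y.1 = 0 then 2 * (A - σ • 1) x.2 y.2 else 0
    have hr₁ : B₁.rank ≤ 2 ^ (2 * j) := by
      refine (B₁.rank_le_of_eq_sum (γ := Fin (2 * j) → Fin 2)
        (fun x g => (-1) ^ ((x.1 : ℕ) + 1) * if x.2 = g then 1 else 0)
        (fun g y => (-1) ^ (y.1 : ℕ) * A g y.2) fun x y => ?_).trans (by simp)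
      rw [Fintype.sum_eq_single x.2 (fun b hb => by simp [hb.symm])]
      simp only [B₁, Matrix.of_apply, if_true]
      ring
    have hr₂ : B₂.rank ≤ (A - σ • 1).rank := by
      obtain ⟨C, D, hCD⟩ := (A - σ • 1).exists_eq_mul_of_rank
      refine (B₂.rank_le_of_eq_sum (γ := Fin (A - σ • 1).rank)
        (fun x g => if x.1 = 0 then 2 * C x.2 g else 0)
        (fun g y => if y.1 = 0 then D g y.2 else 0) fun x y => ?_).trans (by simp)
      simp only [B₂, Matrix.of_apply]
      by_cases hx : x.1 = 0 <;> by_cases hy : y.1 = 0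
      · simp only [hx, hy, and_self, if_true]
        conv_lhs => rw [hCD]
        rw [Matrix.mul_apply, mul_sum]
        exact sum_congr rfl fun g _ => (mul_assoc _ _ _).symm
      all_goals simp [hx, hy]
    have := probabilisticRank_le_of_equiv K e (B₁ + B₂) δ (fun x y => x.1 = 0 ∧ x = y)
      (fun x y hxy => ?_) (fun x => ?_)
    · have h3 := B₁.rank_add_le B₂
      rw [pow_succ]
      omega
    · have hw : walshHadamard K (2 * j + 1) x y =
          (-1) ^ (((e x).1 : ℕ) * ((e y).1 : ℕ)) * A (e x).2 (e y).2 := by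
        rw [walshHadamard_eq_signMatrix, signMatrix, Fin.prod_univ_succ]
        rfl
      rw [hw]
      generalize e x = x' at *
      generalize e y = y' at *
      obtain ⟨a, u⟩ := x'
      obtain ⟨b, v⟩ := y'
      simp only [B₁, B₂, Matrix.add_apply, Matrix.of_apply, Prod.mk.injEq] at hxy ⊢
      fin_cases a <;> fin_cases b
      · have huv : u ≠ v := by simpa using hxy
        simp [Matrix.one_apply_ne huv]
        ring
      all_goals norm_num
    · refine le_trans ?_ hδ
      have : #{y | x.1 = 0 ∧ x = y} ≤ 1 :=
        (card_le_card (t := {x}) fun y hy => by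
          simp only [mem_filter] at hy
          simp [hy.2.2]).trans (by simp)
      exact_mod_cast this

/-- Splits `m * k + r` coordinates into `m` blocks of size `k` and a remainder of size `r`. -/
def blockEquiv (m k r : ℕ) :
    (Fin (m * k + r) → Fin 2) ≃ (Fin m → Fin k → Fin 2) × (Fin r → Fin 2) :=
  (Equiv.arrowCongr finSumFinEquiv.symm (Equiv.refl _)).trans
    ((Equiv.sumArrowEquivProdArrow _ _ _).trans
      (Equiv.prodCongr ((Equiv.arrowCongr finProdFinEquiv.symm (Equiv.refl _)).trans
        (Equiv.curry _ _ _)) (Equiv.refl _)))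

theorem walshHadamard_blockEquiv (m k r : ℕ) (x y : Fin (m * k + r) → Fin 2) :
    walshHadamard K (m * k + r) x y =
      (∏ i, signMatrix K (Fin k) ((blockEquiv m k r x).1 i) ((blockEquiv m k r y).1 i)) *
        signMatrix K (Fin r) (blockEquiv m k r x).2 (blockEquiv m k r y).2 := by
  rw [walshHadamard_eq_signMatrix, signMatrix, ← finSumFinEquiv.prod_comp,
    Fintype.prod_sum_type, ← finProdFinEquiv.prod_comp, Fintype.prod_prod_type]
  rfl

theorem probabilisticRank_walshHadamard_le_of_blocks (h2 : (2 : K) ≠ 0) (j m r t : ℕ) (hj : 0 < j)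
    (hm : 0 < m) (z δ : ℝ) (hz : 0 < z) (hz1 : z ≤ 1)
    (hδ : 2 ^ r * (Real.exp (m * (z * 2 ^ (2 * j))) / z ^ t) ≤ δ * 2 ^ (m * (2 * j) + r)) :
    (probabilisticRank (walshHadamard K (m * (2 * j) + r)) δ : ℝ) ≤
      2 * 2 ^ (m * (2 * j) + r) * Real.exp (-((t : ℝ) ^ 2 / (2 * m))) := by
  classical
  set k := 2 * j with hk
  have : Nonempty (Fin k) := ⟨⟨0, by omega⟩⟩
  set s : K := 2 ^ j
  have hs : s ≠ 0 := pow_ne_zero _ h2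
  have hss : s * s = 2 ^ Fintype.card (Fin k) := by
    rw [Fintype.card_fin, hk, two_mul, pow_add]
  set H := signMatrix K (Fin k)
  -- The complementary spectral projections of `H`, for the eigenvalues `-s` and `s`.
  let P : Matrix (Fin k → Fin 2) (Fin k → Fin 2) K := (-(2 * s)⁻¹) • (H - s • 1)
  let Q : Matrix (Fin k → Fin 2) (Fin k → Fin 2) K := (2 * s)⁻¹ • (H - (-s) • 1)
  have hP : P.rank ≤ 2 ^ (k - 1) := by
    have h := rank_signMatrix_sub_le_half K s hss
    rw [Fintype.card_fin] at h
    exact (Matrix.rank_smul_le _ _).trans h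
  have hQ : Q.rank ≤ 2 ^ (k - 1) := by
    have h := rank_signMatrix_sub_le_half K (-s) (by rw [neg_mul_neg, hss])
    rw [Fintype.card_fin] at h
    exact (Matrix.rank_smul_le _ _).trans h
  have hPQ : P + Q = 1 := by
    ext x y
    simp only [P, Q, Matrix.add_apply, Matrix.smul_apply, Matrix.sub_apply, smul_eq_mul]
    field_simp
    ring
  have hH : s • (Q - P) = H := by
    ext x y
    simp only [P, Q, Matrix.smul_apply, Matrix.sub_apply, smul_eq_mul]
    field_simp
    ring
  obtain ⟨B, hBr, hB⟩ := exists_block_approximation P Q hPQ s (signMatrix K (Fin r)) _ m t hP hQ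
  have hle := probabilisticRank_le_of_equiv K (blockEquiv m k r) B δ
    (fun x y => #{i | x.1 i ≠ y.1 i} ≤ t)
    (fun x y hxy => by
      rw [hB _ _ (not_le.1 hxy), hH, walshHadamard_blockEquiv])
    (fun x => by
      refine le_trans ?_ hδ
      have hb := card_hamming_ball_mul_le x.1 t z hz hz1
      rw [← le_div_iff₀ (by positivity)] at hb
      have hc : #{y : (Fin m → Fin k → Fin 2) × (Fin r → Fin 2) | #{i | x.1 i ≠ y.1 i} ≤ t} =
          2 ^ r * #{y : Fin m → Fin k → Fin 2 | #{i | x.1 i ≠ y i} ≤ t} := by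
        have : ({y : (Fin m → Fin k → Fin 2) × (Fin r → Fin 2) | #{i | x.1 i ≠ y.1 i} ≤ t} :
            Finset _) = ({y : Fin m → Fin k → Fin 2 | #{i | x.1 i ≠ y i} ≤ t} : Finset _) ×ˢ
              (univ : Finset (Fin r → Fin 2)) := by
          ext y
          simp
        rw [this, card_product, mul_comm]
        simp
      rw [hc]
      push_cast
      refine mul_le_mul_of_nonneg_left (hb.trans (le_of_eq ?_)) (by positivity)
      simp)
  have hdev := card_deviation_le (univ : Finset (Fin m)) t (by positivity) (by simpa using hm)
  simp only [univ_inter, card_univ, Fintype.card_fin] at hdev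
  have hpow : (2 : ℝ) ^ (m * k + r) = 2 ^ m * ((2 ^ (k - 1)) ^ m * 2 ^ r) := by
    obtain ⟨i, hi⟩ : ∃ i, k = i + 1 := ⟨k - 1, by omega⟩
    rw [hi, Nat.add_sub_cancel]
    ring
  calc (probabilisticRank (walshHadamard K (m * k + r)) δ : ℝ)
      ≤ (#{V : Finset (Fin m) | (t : ℝ) ≤ |(m : ℝ) - 2 * #V|} : ℝ) *
        ((2 ^ (k - 1)) ^ m * 2 ^ r) := by
        have := hle.trans hBr
        simp only [Fintype.card_pi, Fintype.card_fin, prod_const, card_univ] at this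
        exact_mod_cast this
    _ ≤ (2 * 2 ^ m * Real.exp (-((t : ℝ) ^ 2 / (2 * m)))) * ((2 ^ (k - 1)) ^ m * 2 ^ r) := by
        gcongr
    _ = _ := by rw [hpow]; ring

end constructions

/-! ### Choice of parameters for the first bound -/

section parameters

variable (K : Type*) [Field K]

theorem probabilisticRank_walshHadamard_le_of_large (h2 : (2 : K) ≠ 0) (ε L : ℝ)
    (hε : ε = Real.exp (-L)) (hL : 4 ≤ L) (n : ℕ) (hn : 10240 * L / ε ^ 2 < n) (δ : ℝ)
    (hδ : δ * 2 ^ n = (2 : ℝ) ^ ((n : ℝ) * ε)) :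
    (probabilisticRank (walshHadamard K n) δ : ℝ) ≤
      (2 : ℝ) ^ ((n : ℝ) - 1 / 40960 * (ε ^ 2 / L) * (n : ℝ)) := by
  have hε0 : 0 < ε := hε ▸ Real.exp_pos _
  have hε1 : ε ≤ 1 := by rw [hε]; exact Real.exp_le_one_iff.2 (by linarith)
  have hL0 : 0 < L := by linarith
  have hnL : 10240 * L < n * ε ^ 2 := (div_lt_iff₀ (by positivity)).1 hn
  have hnε : 10240 * L < n * ε := by nlinarith [mul_nonneg (Nat.cast_nonneg (α := ℝ) n) hε0.le]
  have hn1 : 10240 * L < n := by nlinarith [Nat.cast_nonneg (α := ℝ) n]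
  -- Blocks have size `2j`, between `4L` and `5L`, so `log(1/ε) = L` is at most a quarter of the
  -- block size.
  set j := ⌈2 * L⌉₊
  have hj1 : 2 * L ≤ j := Nat.le_ceil _
  have hj2 : (j : ℝ) < 2 * L + 1 := Nat.ceil_lt_add_one (by positivity)
  have hj : 0 < j := by
    rw [← Nat.cast_pos (α := ℝ)]
    linarith
  set m := n / (2 * j) with hm_def
  set r := n % (2 * j) with hr_def
  have hnm : m * (2 * j) + r = n := Nat.div_add_mod' _ _
  have hnm' : (m : ℝ) * (2 * j) + r = n := by exact_mod_cast hnm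
  have hmn : (m : ℝ) ≤ n := Nat.cast_le.2 (Nat.div_le_self _ _)
  have hr : (r : ℝ) ≤ 2 * j := by exact_mod_cast (Nat.mod_lt n (by omega : 0 < 2 * j)).le
  have hm : (n : ℝ) ≤ 10 * L * m := by
    have h1 : (n : ℝ) ≤ 2 * j * (m + 1) := by nlinarith
    have h2 : 2 * (j : ℝ) ≤ 5 * L := by linarith
    have h3 : (n : ℝ) ≤ 5 * L * (m + 1) := h1.trans (by gcongr)
    nlinarith
  have hmε : 1024 ≤ m * ε := by
    have : 10 * L * 1024 ≤ 10 * L * (m * ε) := by nlinarith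
    exact le_of_mul_le_mul_left this (by positivity)
  have hm0 : (0 : ℝ) < m := by
    by_contra h
    nlinarith
  set t := ⌊ε * m / 8⌋₊
  have ht1 : (t : ℝ) ≤ ε * m / 8 := Nat.floor_le (by positivity)
  have ht2 : ε * m / 16 ≤ t := by linarith [Nat.lt_floor_add_one (ε * m / 8)]
  have hlog2 : 0.69 < Real.log 2 := by linarith [Real.log_two_gt_d9]
  have hlog2' : Real.log 2 < 0.7 := by linarith [Real.log_two_lt_d9]
  -- This `z` makes the exponential in the ball bound `exp (m ε / 8)`.
  have key := probabilisticRank_walshHadamard_le_of_blocks K h2 j m r t hj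
    (by exact_mod_cast hm0) (ε / 8 / 2 ^ (2 * j)) δ (by positivity)
    (div_le_one_of_le₀ (le_trans (by linarith) (one_le_pow₀ (by norm_num))) (by positivity)) ?_
  · rw [hnm] at key
    refine key.trans ?_
    set X := ε ^ 2 * n / (5120 * L) with hX
    -- The threshold on `n` serves here: `exp (X / 2)` must absorb the factor 2.
    have hX2 : 2 ≤ X := by
      rw [hX, le_div_iff₀ (by positivity)]
      linarith
    have hXt : X ≤ (t : ℝ) ^ 2 / (2 * m) := by
      rw [hX, div_le_div_iff₀ (by positivity) (by positivity)]
      have h1 : (ε * m / 16) ^ 2 ≤ (t : ℝ) ^ 2 := by gcongr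
      calc ε ^ 2 * n * (2 * m) ≤ ε ^ 2 * (10 * L * m) * (2 * m) := by gcongr
        _ = (ε * m / 16) ^ 2 * (5120 * L) := by ring
        _ ≤ _ := by gcongr
    have he : (2 : ℝ) ≤ Real.exp (X / 2) := by linarith [Real.add_one_le_exp (X / 2)]
    have hrhs : (2 : ℝ) ^ ((n : ℝ) - 1 / 40960 * (ε ^ 2 / L) * (n : ℝ)) =
        2 ^ n * Real.exp (-(X / 8 * Real.log 2)) := by
      rw [Real.rpow_sub (by norm_num), Real.rpow_natCast, Real.rpow_def_of_pos (by norm_num),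
        div_eq_mul_inv, ← Real.exp_neg]
      congr 3
      rw [hX]
      field_simp
      ring
    rw [hrhs]
    calc 2 * 2 ^ n * Real.exp (-((t : ℝ) ^ 2 / (2 * m)))
        ≤ Real.exp (X / 2) * 2 ^ n * Real.exp (-X) := by gcongr
      _ = 2 ^ n * Real.exp (-(X / 2)) := by
          rw [mul_comm (Real.exp (X / 2)), mul_assoc, ← Real.exp_add]
          congr 2
          ring
      _ ≤ _ := by
          gcongr
          nlinarith
  · rw [hnm, hδ]
    have h8 : Real.log 8 ≤ L := by
      rw [show (8 : ℝ) = 2 ^ 3 by norm_num, Real.log_pow]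
      push_cast
      linarith
    -- The exponent is at most `2L + 0.7 * 2j`, and `2L ≤ j = 0.5 * 2j`.
    have hz : (ε / 8 / 2 ^ (2 * j))⁻¹ ≤ Real.exp (2 * j * 1.2) := by
      have hval : (ε / 8 / 2 ^ (2 * j))⁻¹ = Real.exp (L + Real.log 8 + 2 * j * Real.log 2) := by
        rw [Real.exp_add, Real.exp_add, Real.exp_log (by norm_num), hε, Real.exp_neg,
          show (2 : ℝ) * j * Real.log 2 = ((2 * j : ℕ) : ℝ) * Real.log 2 by push_cast; ring,
          Real.exp_nat_mul, Real.exp_log (by norm_num)]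
        field_simp
      rw [hval, Real.exp_le_exp]
      nlinarith
    have hcancel : (m : ℝ) * (ε / 8 / 2 ^ (2 * j) * 2 ^ (2 * j)) = m * (ε / 8) := by
      rw [div_mul_cancel₀ _ (by positivity)]
    rw [hcancel, div_eq_mul_inv, ← inv_pow, Real.rpow_def_of_pos (by norm_num)]
    have h2r : (2 : ℝ) ^ r = Real.exp (r * Real.log 2) := by
      rw [Real.exp_nat_mul, Real.exp_log (by norm_num)]
    calc (2 : ℝ) ^ r * (Real.exp (m * (ε / 8)) * (ε / 8 / 2 ^ (2 * j))⁻¹ ^ t)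
        ≤ Real.exp (r * Real.log 2) *
          (Real.exp (m * (ε / 8)) * Real.exp (2 * j * 1.2) ^ t) := by
          rw [h2r]
          gcongr
      _ = Real.exp (r * Real.log 2 + (m * (ε / 8) + t * (2 * j * 1.2))) := by
          rw [← Real.exp_nat_mul, ← Real.exp_add, ← Real.exp_add]
      _ ≤ _ := by
          rw [Real.exp_le_exp]
          have e1 : r * Real.log 2 ≤ 5 * L := by nlinarith
          have e2 : (t : ℝ) * (2 * j) ≤ ε * n / 8 := by
            calc (t : ℝ) * (2 * j) ≤ ε * m / 8 * (2 * j) := by gcongr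
              _ = ε * (m * (2 * j)) / 8 := by ring
              _ ≤ ε * n / 8 := by
                gcongr
                linarith [Nat.cast_nonneg (α := ℝ) r]
          have e3 : (m : ℝ) * ε ≤ n * ε := mul_le_mul_of_nonneg_right hmn hε0.le
          have e4 : 0.69 * (n * ε) ≤ Real.log 2 * (n * ε) :=
            mul_le_mul_of_nonneg_right hlog2.le (by positivity)
          linarith

theorem probabilisticRank_walshHadamard_le_rpow_sub (ε L : ℝ)
    (hε : ε = Real.exp (-L)) (hL : 4 ≤ L) (n : ℕ) :
    (probabilisticRank (walshHadamard K n) (1 / (2 : ℝ) ^ ((n : ℝ) * (1 - ε))) : ℝ) ≤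
      (2 : ℝ) ^ ((n : ℝ) - 1 / 40960 * (ε ^ 2 / L) * (n : ℝ)) := by
  have hε0 : 0 < ε := hε ▸ Real.exp_pos _
  have hε1 : ε ≤ 1 := by rw [hε]; exact Real.exp_le_one_iff.2 (by linarith)
  have hδ0 : (0 : ℝ) ≤ 1 / (2 : ℝ) ^ ((n : ℝ) * (1 - ε)) := by positivity
  have hδ : 1 / (2 : ℝ) ^ ((n : ℝ) * (1 - ε)) * 2 ^ n = (2 : ℝ) ^ ((n : ℝ) * ε) := by
    rw [← Real.rpow_natCast, one_div, ← Real.rpow_neg (by norm_num),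
      ← Real.rpow_add (by norm_num)]
    congr 1
    ring
  rcases Nat.eq_zero_or_pos n with rfl | hn
  · have h := probabilisticRank_walshHadamard_le_two_pow K 0 _ hδ0
    rw [pow_zero] at h
    refine (Nat.cast_le.2 h).trans ?_
    simp
  by_cases h2 : (2 : K) = 0
  · have h := probabilisticRank_walshHadamard_le_one_of_two_eq_zero K h2 n _ hδ0
    refine (Nat.cast_le.2 h).trans ?_
    rw [Nat.cast_one]
    refine Real.one_le_rpow (by norm_num) ?_
    have h3 : ε ^ 2 / L ≤ 1 := div_le_one_of_le₀ (by nlinarith) (by linarith)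
    nlinarith [Nat.cast_nonneg (α := ℝ) n]
  rcases lt_or_ge (10240 * L / ε ^ 2) (n : ℝ) with hlarge | hsmall
  · exact probabilisticRank_walshHadamard_le_of_large K h2 ε L hε hL n hlarge _ hδ
  · have h := probabilisticRank_walshHadamard_le_three_quarters K n hn
      (1 / (2 : ℝ) ^ ((n : ℝ) * (1 - ε))) (by
        rw [hδ]
        exact Real.one_le_rpow (by norm_num) (by positivity))
    have h' : 4 * (probabilisticRank (walshHadamard K n) (1 / (2 : ℝ) ^ ((n : ℝ) * (1 - ε))) : ℝ)
        ≤ 3 * 2 ^ n := by exact_mod_cast h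
    -- Below the threshold the required saving is at most `2 ^ (1/4)`, which the factor `3/4`
    -- provides.
    have hexp : (n : ℝ) - 1 / 4 ≤ n - 1 / 40960 * (ε ^ 2 / L) * n := by
      have : ε ^ 2 / L * n ≤ 10240 := by
        calc ε ^ 2 / L * n ≤ ε ^ 2 / L * (10240 * L / ε ^ 2) := by gcongr
          _ = 10240 := by field_simp
      linarith
    have hquarter : (3 / 4 : ℝ) ≤ (2 : ℝ) ^ (-(1 / 4) : ℝ) := by
      rw [Real.rpow_def_of_pos (by norm_num)]
      linarith [Real.add_one_le_exp (Real.log 2 * -(1 / 4)), Real.log_two_lt_d9]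
    calc _ ≤ (2 : ℝ) ^ n * (3 / 4) := by linarith
      _ ≤ (2 : ℝ) ^ n * (2 : ℝ) ^ (-(1 / 4) : ℝ) := by gcongr
      _ = (2 : ℝ) ^ ((n : ℝ) - 1 / 4) := by
          rw [← Real.rpow_natCast, ← Real.rpow_add (by norm_num), sub_eq_add_neg]
      _ ≤ _ := Real.rpow_le_rpow_of_exponent_le (by norm_num) hexp

end parameters

end WalshHadamardRank

theorem mainTheorem9 :
    ∃ c C ε₀ : ℝ, 0 < c ∧ 0 < C ∧ 0 < ε₀ ∧
      ∀ (K : Type*) [Field K] (ε : ℝ), 0 < ε → ε < ε₀ →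
        (∀ n : ℕ,
          (probabilisticRank (walshHadamard K n) (1 / (2 : ℝ) ^ ((n : ℝ) * (1 - ε))) : ℝ) ≤
            (2 : ℝ) ^ ((n : ℝ) - c * (ε ^ 2 / Real.log (1 / ε)) * (n : ℝ))) ∧
        (∀ n : ℕ, 2 ≤ n →
          (probabilisticRank (walshHadamard K n) ε : ℝ) ≤
            (1 / ε) ^ (C * (Real.sqrt n * Real.log n))) := by
  refine ⟨1 / 40960, 4, Real.exp (-4), by norm_num, by norm_num, Real.exp_pos _,
    fun K _ ε hε hε' => ⟨fun n => ?_, fun n hn => ?_⟩⟩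
  · have hεL : ε = Real.exp (-Real.log (1 / ε)) := by
      rw [one_div, Real.log_inv, neg_neg, Real.exp_log hε]
    refine probabilisticRank_walshHadamard_le_rpow_sub K ε _ hεL ?_ n
    rw [hεL, Real.exp_lt_exp] at hε'
    linarith
  · exact probabilisticRank_walshHadamard_le_rpow K ε hε
      (hε'.trans (Real.exp_lt_exp.2 (by norm_num))) n hn
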